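/- Let $G$ be a triangle-free (finite, simple) graph on $n\ge 1$ vertices, with adjacency matrix $A$ and diagonal degree matrix $D$. Let $q_n(G)$ denote the smallest eigenvalue of the signless Laplacian matrix $Q=A+D$, and let $\lambda_1(G)\ge\dots\ge\lambda_n(G)$ denote the eigenvalues of $A$. Then $$q_n(G)\le \frac{15}{94}\cdot n<0.1596\,n .$$ Moreover, if $G$ is $d$-regular for some $d$, then $$\lambda_1(G)+\lambda_n(G)<0.1596\,n<\frac{4n}{25}.$$ -/

import Mathlib

namespace TriangleFreeSpectra

/-- The largest eigenvalue of a Hermitian matrix of positive size: the first entry of the list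
of its eigenvalues (with multiplicity) in decreasing order. -/
noncomputable def largestEigenvalue {V : Type*} [Fintype V] [DecidableEq V] [Nonempty V]
    {M : Matrix V V ℝ} (hM : M.IsHermitian) : ℝ :=
  hM.eigenvalues₀ ⟨0, Fintype.card_pos⟩

/-- The smallest eigenvalue of a Hermitian matrix of positive size: the last entry of the list
of its eigenvalues (with multiplicity) in decreasing order. -/
noncomputable def smallestEigenvalue {V : Type*} [Fintype V] [DecidableEq V] [Nonempty V]
    {M : Matrix V V ℝ} (hM : M.IsHermitian) : ℝ :=
  hM.eigenvalues₀ ⟨Fintype.card V - 1, Nat.sub_lt Fintype.card_pos Nat.one_pos⟩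

/-- The signless Laplacian matrix `Q = A + D` of a finite graph. -/
def signlessLapMatrix {V : Type*} [Fintype V] [DecidableEq V]
    (G : SimpleGraph V) [DecidableRel G.Adj] : Matrix V V ℝ :=
  G.adjMatrix ℝ + G.degMatrix ℝ

theorem isHermitian_signlessLapMatrix {V : Type*} [Fintype V] [DecidableEq V]
    (G : SimpleGraph V) [DecidableRel G.Adj] : (signlessLapMatrix G).IsHermitian :=
  (G.isHermitian_adjMatrix ℝ).add (G.isHermitian_degMatrix ℝ)

/-- `q_n(G)`, the smallest eigenvalue of the signless Laplacian matrix. -/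
noncomputable def qMin {V : Type*} [Fintype V] [DecidableEq V] [Nonempty V]
    (G : SimpleGraph V) [DecidableRel G.Adj] : ℝ :=
  smallestEigenvalue (isHermitian_signlessLapMatrix G)

/-- `λ_1(G)`, the largest eigenvalue of the adjacency matrix. -/
noncomputable def adjMax {V : Type*} [Fintype V] [DecidableEq V] [Nonempty V]
    (G : SimpleGraph V) [DecidableRel G.Adj] : ℝ :=
  largestEigenvalue (G.isHermitian_adjMatrix ℝ)

/-- `λ_n(G)`, the smallest eigenvalue of the adjacency matrix. -/
noncomputable def adjMin {V : Type*} [Fintype V] [DecidableEq V] [Nonempty V]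
    (G : SimpleGraph V) [DecidableRel G.Adj] : ℝ :=
  smallestEigenvalue (G.isHermitian_adjMatrix ℝ)

end TriangleFreeSpectra

namespace TriangleFreeSpectra

open Matrix

/-! ### Rayleigh bound for the smallest eigenvalue. -/

section Spectral

variable {V : Type*} [Fintype V] [DecidableEq V] {M : Matrix V V ℝ}

/-! A flag-algebra argument. Each vertex `v` yields test vectors `y` whose entries count local
configurations, and `yᵀ Q y ≥ q_n yᵀ y`. Summed over `v`, the form `94 yᵀ Q y - 15 n yᵀ y` is a sum
over 5-tuples of vertices of a function of the induced graph (`homSum_formTerm`). A positive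
combination of two such forms and of sums of squares becomes, after averaging over labels,
nonpositive on every triangle-free graph on five labels: a finite check, `certificate_symm_nonpos`.
Hence `94 q_n - 15 n` cannot be positive. For `d`-regular graphs `Q = A + d I` and `λ_1 ≤ d`, so
`λ_1 + λ_n ≤ q_n`. -/

theorem smallestEigenvalue_le_eigenvalues [Nonempty V] (hM : M.IsHermitian) (i : V) :
    smallestEigenvalue hM ≤ hM.eigenvalues i :=
  hM.eigenvalues₀_antitone (Fin.le_def.2 (Nat.le_sub_one_of_lt (Fin.is_lt _)))

/-- Every entry of the ordered list of eigenvalues has a nonzero eigenvector. -/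
theorem exists_mulVec_eq_eigenvalues₀_smul (hM : M.IsHermitian) (k : Fin (Fintype.card V)) :
    ∃ y : V → ℝ, y ≠ 0 ∧ M *ᵥ y = hM.eigenvalues₀ k • y := by
  let i : V := Fintype.equivOfCardEq (Fintype.card_fin _) k
  have hi : hM.eigenvalues i = hM.eigenvalues₀ k := by simp [IsHermitian.eigenvalues, i]
  refine ⟨hM.eigenvectorBasis i, fun h => ?_, hi ▸ hM.mulVec_eigenvectorBasis i⟩
  exact hM.eigenvectorBasis.orthonormal.ne_zero i (WithLp.ofLp_injective 2 h)

theorem smallestEigenvalue_le_of_mulVec_eq [Nonempty V] (hM : M.IsHermitian) {y : V → ℝ} (hy : y ≠ 0) {μ : ℝ}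
    (h : M *ᵥ y = μ • y) : smallestEigenvalue hM ≤ μ := by
  have hμ : μ ∈ spectrum ℝ M := by
    rw [← Matrix.spectrum_toLin']
    exact (Module.End.hasEigenvalue_of_hasEigenvector (x := y)
      ⟨Module.End.mem_eigenspace_iff.2 (by simpa using h), hy⟩).mem_spectrum
  rw [hM.spectrum_real_eq_range_eigenvalues] at hμ
  obtain ⟨i, rfl⟩ := hμ
  exact smallestEigenvalue_le_eigenvalues hM i

/-- With `q` the smallest eigenvalue, an eigenvalue `μ` of `M - q I` makes `μ + q` an eigenvalue of
`M`, so `μ ≥ 0` and `M - q I` is positive semidefinite. -/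
theorem smallestEigenvalue_mul_dotProduct_le [Nonempty V] (hM : M.IsHermitian) (y : V → ℝ) :
    smallestEigenvalue hM * (y ⬝ᵥ y) ≤ y ⬝ᵥ M *ᵥ y := by
  set q := smallestEigenvalue hM with hq
  have hN : (M - q • (1 : Matrix V V ℝ)).IsHermitian :=
    hM.sub (by simp [IsHermitian])
  have hpos : (M - q • (1 : Matrix V V ℝ)).PosSemidef := by
    rw [hN.posSemidef_iff_eigenvalues_nonneg]
    intro i
    have h := hN.mulVec_eigenvectorBasis i
    have := smallestEigenvalue_le_of_mulVec_eq hM (y := hN.eigenvectorBasis i)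
      (μ := hN.eigenvalues i + q)
      (fun h => hN.eigenvectorBasis.orthonormal.ne_zero i (WithLp.ofLp_injective 2 h)) (by
        rw [sub_mulVec, smul_mulVec, one_mulVec, sub_eq_iff_eq_add] at h
        rw [h, add_smul])
    simpa [← hq] using this
  have := hpos.dotProduct_mulVec_nonneg y
  simp only [sub_mulVec, smul_mulVec, one_mulVec, dotProduct_sub, dotProduct_smul, star_trivial,
    smul_eq_mul] at this
  linarith

end Spectral

/-! ### Quadratic form of `Q`, and the regular case. -/

section Graph

variable {V : Type*} [Fintype V] [DecidableEq V] (G : SimpleGraph V) [DecidableRel G.Adj]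

omit [DecidableEq V] in
theorem sum_adjMatrix_apply (v : V) : ∑ w, G.adjMatrix ℝ v w = G.degree v := by
  simp [SimpleGraph.adjMatrix_apply, ← SimpleGraph.card_neighborFinset_eq_degree,
    SimpleGraph.neighborFinset_eq_filter]

theorem signlessLapMatrix_mulVec_apply (y : V → ℝ) (v : V) :
    (signlessLapMatrix G *ᵥ y) v = ∑ w, G.adjMatrix ℝ v w * (y v + y w) := by
  have hd : G.degMatrix ℝ *ᵥ y = fun v => (G.degree v : ℝ) * y v := by
    ext v; simp [SimpleGraph.degMatrix, mulVec_diagonal]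
  rw [signlessLapMatrix, add_mulVec, hd]
  simp only [Pi.add_apply, mul_add, Finset.sum_add_distrib, ← Finset.sum_mul]
  rw [sum_adjMatrix_apply, add_comm]
  rfl

theorem qMin_mul_sum_sq_le [Nonempty V] (y : V → ℝ) :
    qMin G * ∑ v, y v ^ 2 ≤ ∑ v, ∑ w, G.adjMatrix ℝ v w * (y v * y w + y v ^ 2) := by
  have h := smallestEigenvalue_mul_dotProduct_le (isHermitian_signlessLapMatrix G) y
  convert h using 1
  · simp [qMin, dotProduct, sq]
  · simp only [dotProduct, signlessLapMatrix_mulVec_apply, Finset.mul_sum]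
    exact Finset.sum_congr rfl fun v _ => Finset.sum_congr rfl fun w _ => by ring

variable [Nonempty V]

theorem adjMax_le_of_isRegularOfDegree {d : ℕ} (hd : G.IsRegularOfDegree d) : adjMax G ≤ d := by
  obtain ⟨y, hy, h⟩ := exists_mulVec_eq_eigenvalues₀_smul (G.isHermitian_adjMatrix ℝ)
    ⟨0, Fintype.card_pos⟩
  change _ = adjMax G • y at h
  have hrow (v : V) : ∑ w, G.adjMatrix ℝ v w = d := by
    rw [sum_adjMatrix_apply, hd v]
  have hcol (w : V) : ∑ v, G.adjMatrix ℝ v w = d := by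
    rw [← hrow w]
    exact Finset.sum_congr rfl fun v _ => (G.isSymm_adjMatrix (α := ℝ)).apply w v
  have hpos : 0 < y ⬝ᵥ y := by simpa using dotProduct_star_self_pos_iff.2 hy
  have key : y ⬝ᵥ G.adjMatrix ℝ *ᵥ y ≤ d * (y ⬝ᵥ y) := by
    calc y ⬝ᵥ G.adjMatrix ℝ *ᵥ y = ∑ v, ∑ w, G.adjMatrix ℝ v w * (y v * y w) := by
          simp only [dotProduct, mulVec, Finset.mul_sum]
          exact Finset.sum_congr rfl fun v _ => Finset.sum_congr rfl fun w _ => by ring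
      _ ≤ ∑ v, ∑ w, (G.adjMatrix ℝ v w * (y v ^ 2 / 2) + G.adjMatrix ℝ v w * (y w ^ 2 / 2)) := by
          gcongr with v _ w _
          rw [← mul_add]
          refine mul_le_mul_of_nonneg_left ?_ ?_
          -- AM-GM on each edge; row and column sums `d` then give the bound.
          · linarith [two_mul_le_add_sq (y v) (y w)]
          · rw [SimpleGraph.adjMatrix_apply]; positivity
      _ = d * (y ⬝ᵥ y) := by
          simp only [Finset.sum_add_distrib]
          rw [Finset.sum_comm (f := fun v w => G.adjMatrix ℝ v w * (y w ^ 2 / 2))]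
          simp only [← Finset.sum_mul, hrow, hcol, ← Finset.mul_sum, ← Finset.sum_div, dotProduct,
            ← sq]
          ring
  rw [h, dotProduct_smul, smul_eq_mul] at key
  exact le_of_mul_le_mul_right key hpos

theorem add_adjMin_le_qMin {d : ℕ} (hd : G.IsRegularOfDegree d) : d + adjMin G ≤ qMin G := by
  obtain ⟨y, hy, h⟩ := exists_mulVec_eq_eigenvalues₀_smul (isHermitian_signlessLapMatrix G)
    ⟨Fintype.card V - 1, Nat.sub_lt Fintype.card_pos Nat.one_pos⟩
  change _ = qMin G • y at h
  have hA : G.adjMatrix ℝ *ᵥ y = (qMin G - d) • y := by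
    have hD : G.degMatrix ℝ *ᵥ y = (d : ℝ) • y := by
      ext v; simp [SimpleGraph.degMatrix, mulVec_diagonal, hd v]
    rw [sub_smul, ← h, signlessLapMatrix, add_mulVec, hD, add_sub_cancel_right]
  have := smallestEigenvalue_le_of_mulVec_eq (G.isHermitian_adjMatrix ℝ) hy hA
  change adjMin G ≤ _ at this
  linarith

end Graph

/-! ### Symmetrization and the finite certificate. -/

section FiveVertices

/-- An integer-valued function of a labelled graph on the vertices `0, …, 4`, given by the
indicators of its ten potential edges `01, 02, 03, 04, 12, 13, 14, 23, 24, 34`. -/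
abbrev GraphFun := Bool → Bool → Bool → Bool → Bool → Bool → Bool → Bool → Bool → Bool → ℤ

namespace GraphFun

/-- Exchange the labels `0` and `1`. -/
def swap01 (F : GraphFun) : GraphFun := fun b01 b02 b03 b04 b12 b13 b14 b23 b24 b34 =>
  F b01 b12 b13 b14 b02 b03 b04 b23 b24 b34

/-- Exchange the labels `1` and `2`. -/
def swap12 (F : GraphFun) : GraphFun := fun b01 b02 b03 b04 b12 b13 b14 b23 b24 b34 =>
  F b02 b01 b03 b04 b12 b23 b24 b13 b14 b34

/-- Exchange the labels `2` and `3`. -/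
def swap23 (F : GraphFun) : GraphFun := fun b01 b02 b03 b04 b12 b13 b14 b23 b24 b34 =>
  F b01 b03 b02 b04 b13 b12 b14 b23 b34 b24

/-- Exchange the labels `3` and `4`. -/
def swap34 (F : GraphFun) : GraphFun := fun b01 b02 b03 b04 b12 b13 b14 b23 b24 b34 =>
  F b01 b02 b04 b03 b12 b14 b13 b24 b23 b34

/-- Pointwise sum. -/
def add (F F' : GraphFun) : GraphFun := fun b01 b02 b03 b04 b12 b13 b14 b23 b24 b34 =>
  F b01 b02 b03 b04 b12 b13 b14 b23 b24 b34 + F' b01 b02 b03 b04 b12 b13 b14 b23 b24 b34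

/-- Sum over the relabellings of `0, 1`. -/
def symm2 (F : GraphFun) : GraphFun := F.add F.swap01

/-- Given symmetry in `0, 1`, the sum over coset representatives that symmetrizes `0, 1, 2`. -/
def symm3 (F : GraphFun) : GraphFun := F.add (F.swap12.add F.swap12.swap01)

/-- Given symmetry in `0, 1, 2`, the sum over coset representatives that symmetrizes
`0, 1, 2, 3`. -/
def symm4 (F : GraphFun) : GraphFun :=
  F.add (F.swap23.add (F.swap23.swap12.add F.swap23.swap12.swap01))

/-- Given symmetry in `0, 1, 2, 3`, the sum over coset representatives that symmetrizes all
five labels. -/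
def symm5 (F : GraphFun) : GraphFun :=
  F.add (F.swap34.add (F.swap34.swap23.add (F.swap34.swap23.swap12.add
    F.swap34.swap23.swap12.swap01)))

/-- The sum over all relabellings. -/
def symm (F : GraphFun) : GraphFun := F.symm2.symm3.symm4.symm5

/-- The sum of `F` over the graphs that a relation `a` induces on all 5-tuples of vertices. -/
def homSum {V : Type*} [Fintype V] (a : V → V → Bool) (F : GraphFun) : ℤ :=
  ∑ v, ∑ w, ∑ x, ∑ y, ∑ z,
    F (a v w) (a v x) (a v y) (a v z) (a w x) (a w y) (a w z) (a x y) (a x z) (a y z)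

variable {V : Type*} [Fintype V] {a : V → V → Bool}

theorem homSum_swap01 (ha : ∀ u v, a u v = a v u) (F : GraphFun) :
    homSum a F.swap01 = homSum a F := by
  unfold homSum
  rw [Finset.sum_comm]
  refine Finset.sum_congr rfl fun v _ => Finset.sum_congr rfl fun w _ => ?_
  simp only [swap01, ha w v]

theorem homSum_swap12 (ha : ∀ u v, a u v = a v u) (F : GraphFun) :
    homSum a F.swap12 = homSum a F := by
  unfold homSum
  refine Finset.sum_congr rfl fun v _ => ?_
  rw [Finset.sum_comm]
  refine Finset.sum_congr rfl fun w _ => Finset.sum_congr rfl fun x _ => ?_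
  simp only [swap12, ha x w]

theorem homSum_swap23 (ha : ∀ u v, a u v = a v u) (F : GraphFun) :
    homSum a F.swap23 = homSum a F := by
  unfold homSum
  refine Finset.sum_congr rfl fun v _ => Finset.sum_congr rfl fun w _ => ?_
  rw [Finset.sum_comm]
  refine Finset.sum_congr rfl fun x _ => Finset.sum_congr rfl fun y _ => ?_
  simp only [swap23, ha y x]

theorem homSum_swap34 (ha : ∀ u v, a u v = a v u) (F : GraphFun) :
    homSum a F.swap34 = homSum a F := by
  unfold homSum
  refine Finset.sum_congr rfl fun v _ => Finset.sum_congr rfl fun w _ =>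
    Finset.sum_congr rfl fun x _ => ?_
  rw [Finset.sum_comm]
  refine Finset.sum_congr rfl fun y _ => Finset.sum_congr rfl fun z _ => ?_
  simp only [swap34, ha z y]

theorem homSum_add (F F' : GraphFun) : homSum a (F.add F') = homSum a F + homSum a F' := by
  simp only [homSum, add, Finset.sum_add_distrib]

/-- Each swap only permutes the summation variables, and the coset sums contribute factors `2 · 3 ·
4 · 5 = 120`. -/
theorem homSum_symm (ha : ∀ u v, a u v = a v u) (F : GraphFun) :
    homSum a F.symm = 120 * homSum a F := by
  simp only [symm, symm2, symm3, symm4, symm5, homSum_add, homSum_swap01 ha, homSum_swap12 ha,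
    homSum_swap23 ha, homSum_swap34 ha]
  ring

/-- The graph on `0, …, 4` with the given edges has a triangle. -/
def hasTriangle (b01 b02 b03 b04 b12 b13 b14 b23 b24 b34 : Bool) : Bool :=
  b01 && b02 && b12 || b01 && b03 && b13 || b01 && b04 && b14 || b02 && b03 && b23 ||
  b02 && b04 && b24 || b03 && b04 && b34 || b12 && b13 && b23 || b12 && b14 && b24 ||
  b13 && b14 && b34 || b23 && b24 && b34

/-- Tuples with repeated vertices need no error term: `ha` covers coinciding vertices, so every
tuple induces a triangle-free pattern. -/
theorem homSum_nonpos (hs : ∀ u v, a u v = a v u)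
    (ha : ∀ u v w, ¬ (a u v ∧ a u w ∧ a v w)) {F : GraphFun}
    (hF : ∀ b01 b02 b03 b04 b12 b13 b14 b23 b24 b34,
      hasTriangle b01 b02 b03 b04 b12 b13 b14 b23 b24 b34 ∨
        F.symm b01 b02 b03 b04 b12 b13 b14 b23 b24 b34 ≤ 0) :
    homSum a F ≤ 0 := by
  have h : homSum a F.symm ≤ 0 := by
    unfold homSum
    refine Finset.sum_nonpos fun v _ => Finset.sum_nonpos fun w _ => Finset.sum_nonpos fun x _ =>
      Finset.sum_nonpos fun y _ => Finset.sum_nonpos fun z _ =>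
        (hF _ _ _ _ _ _ _ _ _ _).resolve_left ?_
    have (u v w : V) : (a u v && a u w && a v w) = false := by
      have := ha u v w
      simp only [Bool.and_eq_false_iff]
      revert this
      cases a u v <;> cases a u w <;> cases a v w <;> simp
    simp [hasTriangle, this]
  rw [homSum_symm hs] at h
  linarith

end GraphFun

/-- The summand at `z` of the entry at `w` of a test vector attached to a vertex `v`, as a function
of the indicators of the edges `vw`, `vz`, `wz`. -/
def nearVec (p q r : ℤ) : ℤ := 100 * q * r - 40 * p * q - 14 * r + 4 * p - 1

/-- The summand of the test vector that is constant on the neighbours and on the non-neighbours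
of `v`. -/
def farVec (p _q _r : ℤ) : ℤ := 4 * p - 1

/-- A function of three indicators that takes the values `1, 1, -18, 53` according to the number
of ones. -/
def tripleCubic (p q r : ℤ) : ℤ := 1 - 19 * (p * q + p * r + q * r) + 109 * (p * q * r)

/-- A function of three indicators that takes the values `1, 1, -7, 0` according to the number
of ones. -/
def tripleCubicAux (p q r : ℤ) : ℤ := 1 - 8 * (p * q + p * r + q * r) + 23 * (p * q * r)

/-- The summand of `94 yᵀ Q y - 15 n yᵀ y`, where `y w = ∑ z, X (vw) (vz) (wz)`. -/
def formTerm (X : ℤ → ℤ → ℤ → ℤ) : GraphFun := fun b01 b02 b03 b04 b12 b13 b14 _ b24 _ =>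
  94 * b12.toInt * (X b01.toInt b03.toInt b13.toInt * X b02.toInt b04.toInt b24.toInt) +
    (94 * b12.toInt - 15) *
      (X b01.toInt b03.toInt b13.toInt * X b01.toInt b04.toInt b14.toInt)

/-- The summand of `(∑ w, g (uw) (vw) (xw)) ^ 2` over independent triples `u, v, x`. -/
def tripleTerm (g : ℤ → ℤ → ℤ → ℤ) : GraphFun := fun b01 b02 b03 b04 b12 b13 b14 b23 b24 _ =>
  (1 - b01.toInt) * (1 - b02.toInt) * (1 - b12.toInt) *
    (g b03.toInt b13.toInt b23.toInt * g b04.toInt b14.toInt b24.toInt)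

/-- The summand of the squared difference of the codegrees of `u, x` and `v, x` over edges `uv`
and vertices `x` adjacent to neither end. -/
def codegreeTerm : GraphFun := fun b01 b02 b03 b04 b12 b13 b14 b23 b24 _ =>
  b01.toInt * (1 - b02.toInt) * (1 - b12.toInt) *
    ((b03.toInt - b13.toInt) * b23.toInt * ((b04.toInt - b14.toInt) * b24.toInt))

/-- The certificate: a combination of the form terms and of sums of squares. -/
def certificate : GraphFun := fun b01 b02 b03 b04 b12 b13 b14 b23 b24 b34 =>
  16 * formTerm nearVec b01 b02 b03 b04 b12 b13 b14 b23 b24 b34 +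
  150 * formTerm farVec b01 b02 b03 b04 b12 b13 b14 b23 b24 b34 +
  846 * tripleTerm tripleCubic b01 b02 b03 b04 b12 b13 b14 b23 b24 b34 +
  1598 * tripleTerm tripleCubicAux b01 b02 b03 b04 b12 b13 b14 b23 b24 b34 +
  6269800 * codegreeTerm b01 b02 b03 b04 b12 b13 b14 b23 b24 b34

/-- Kernel evaluation over all `2 ^ 10` labelled graphs. -/
theorem certificate_symm_nonpos : ∀ b01 b02 b03 b04 b12 b13 b14 b23 b24 b34,
    GraphFun.hasTriangle b01 b02 b03 b04 b12 b13 b14 b23 b24 b34 ∨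
      certificate.symm b01 b02 b03 b04 b12 b13 b14 b23 b24 b34 ≤ 0 := by
  decide +kernel

end FiveVertices

/-! ### From 5-tuple sums to quadratic forms and squares. -/

section Counting

variable {V : Type*} [Fintype V]

theorem sum_sum_mul_mul (c : ℤ) (f g : V → ℤ) :
    ∑ y, ∑ z, c * (f y * g z) = c * ((∑ y, f y) * ∑ z, g z) := by
  rw [Finset.sum_mul_sum, Finset.mul_sum]
  simp only [Finset.mul_sum]

/-- The test vector attached to `v` with summand `X`. -/
def testVec (a : V → V → Bool) (X : ℤ → ℤ → ℤ → ℤ) (v w : V) : ℤ :=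
  ∑ z, X (a v w).toInt (a v z).toInt (a w z).toInt

theorem homSum_formTerm (a : V → V → Bool) (X : ℤ → ℤ → ℤ → ℤ) :
    GraphFun.homSum a (formTerm X) =
      ∑ v, (94 * ∑ w, ∑ x, (a w x).toInt *
          (testVec a X v w * testVec a X v x + testVec a X v w ^ 2) -
        15 * Fintype.card V * ∑ w, testVec a X v w ^ 2) := by
  unfold GraphFun.homSum formTerm
  refine Finset.sum_congr rfl fun v _ => ?_
  have h (w x : V) : ∑ y, ∑ z, (94 * (a w x).toInt *
        (X (a v w).toInt (a v y).toInt (a w y).toInt * X (a v x).toInt (a v z).toInt (a x z).toInt) +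
      (94 * (a w x).toInt - 15) *
        (X (a v w).toInt (a v y).toInt (a w y).toInt * X (a v w).toInt (a v z).toInt (a w z).toInt)) =
      94 * ((a w x).toInt * (testVec a X v w * testVec a X v x + testVec a X v w ^ 2)) -
        15 * testVec a X v w ^ 2 := by
    simp only [Finset.sum_add_distrib, sum_sum_mul_mul, testVec]
    ring
  -- The square term does not depend on `x`; summing it over `x` produces the factor `n`.
  simp only [h, Finset.sum_sub_distrib, ← Finset.mul_sum, Finset.sum_const, Finset.card_univ,
    nsmul_eq_mul]
  ring

theorem homSum_tripleTerm_nonneg (a : V → V → Bool) (g : ℤ → ℤ → ℤ → ℤ) :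
    0 ≤ GraphFun.homSum a (tripleTerm g) := by
  unfold GraphFun.homSum tripleTerm
  refine Finset.sum_nonneg fun v _ => Finset.sum_nonneg fun w _ => Finset.sum_nonneg fun x _ => ?_
  rw [sum_sum_mul_mul (f := fun y => g (a v y).toInt (a w y).toInt (a x y).toInt)
    (g := fun y => g (a v y).toInt (a w y).toInt (a x y).toInt)]
  refine mul_nonneg ?_ (mul_self_nonneg _)
  cases a v w <;> cases a v x <;> cases a w x <;> decide

theorem homSum_codegreeTerm_nonneg (a : V → V → Bool) :
    0 ≤ GraphFun.homSum a codegreeTerm := by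
  unfold GraphFun.homSum codegreeTerm
  refine Finset.sum_nonneg fun v _ => Finset.sum_nonneg fun w _ => Finset.sum_nonneg fun x _ => ?_
  rw [sum_sum_mul_mul (f := fun y => ((a v y).toInt - (a w y).toInt) * (a x y).toInt)
    (g := fun y => ((a v y).toInt - (a w y).toInt) * (a x y).toInt)]
  refine mul_nonneg ?_ (mul_self_nonneg _)
  cases a v w <;> cases a v x <;> cases a w x <;> decide

theorem homSum_certificate (a : V → V → Bool) :
    GraphFun.homSum a certificate =
      16 * GraphFun.homSum a (formTerm nearVec) + 150 * GraphFun.homSum a (formTerm farVec) +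
      846 * GraphFun.homSum a (tripleTerm tripleCubic) +
      1598 * GraphFun.homSum a (tripleTerm tripleCubicAux) +
      6269800 * GraphFun.homSum a codegreeTerm := by
  simp only [GraphFun.homSum, certificate, Finset.sum_add_distrib, ← Finset.mul_sum]

/-- The squares enter the certificate with positive weights, so they can be dropped. -/
theorem homSum_formTerm_add_nonpos {a : V → V → Bool} (hs : ∀ u v, a u v = a v u)
    (ha : ∀ u v w, ¬ (a u v ∧ a u w ∧ a v w)) :
    16 * GraphFun.homSum a (formTerm nearVec) +
      150 * GraphFun.homSum a (formTerm farVec) ≤ 0 := by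
  have h := GraphFun.homSum_nonpos hs ha certificate_symm_nonpos
  rw [homSum_certificate] at h
  linarith [homSum_tripleTerm_nonneg a tripleCubic, homSum_tripleTerm_nonneg a tripleCubicAux,
    homSum_codegreeTerm_nonneg a]

/-- The entry is `3n` or `-n`. This supplies the strict inequality in the final contradiction. -/
theorem testVec_farVec_ne_zero [Nonempty V] (a : V → V → Bool) (v w : V) :
    testVec a farVec v w ≠ 0 := by
  simp only [testVec, farVec, Finset.sum_const, Finset.card_univ, nsmul_eq_mul]
  refine mul_ne_zero (by simp) ?_
  cases a v w <;> decide

end Counting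

/-! ### The bound on `q_n`. -/

section Main

variable {V : Type*} [Fintype V] [DecidableEq V] [Nonempty V] (G : SimpleGraph V)
  [DecidableRel G.Adj]

theorem qMin_sub_mul_le_homSum_formTerm (X : ℤ → ℤ → ℤ → ℤ) :
    (94 * qMin G - 15 * Fintype.card V) *
        ∑ v, ∑ w, (testVec (fun u v => decide (G.Adj u v)) X v w : ℝ) ^ 2 ≤
      GraphFun.homSum (fun u v => decide (G.Adj u v)) (formTerm X) := by
  have hA (u v : V) : ((decide (G.Adj u v)).toInt : ℝ) = G.adjMatrix ℝ u v := by
    by_cases h : G.Adj u v <;> simp [SimpleGraph.adjMatrix_apply, h]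
  rw [homSum_formTerm, Finset.mul_sum]
  push_cast
  refine Finset.sum_le_sum fun v _ => ?_
  have h := qMin_mul_sum_sq_le G
    fun w => (testVec (fun u v => decide (G.Adj u v)) X v w : ℝ)
  simp only [hA]
  linarith

theorem qMin_le_of_cliqueFree_three (hG : G.CliqueFree 3) :
    qMin G ≤ 15 / 94 * (Fintype.card V : ℝ) := by
  by_contra! hq
  set a : V → V → Bool := fun u v => decide (G.Adj u v) with ha
  have h := homSum_formTerm_add_nonpos (a := a) (fun u v => by simp [ha, G.adj_comm])
    (fun u v w h => hG {u, v, w} (SimpleGraph.is3Clique_triple_iff.2 (by simpa [ha] using h)))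
  have h' : (16 * GraphFun.homSum a (formTerm nearVec) +
      150 * GraphFun.homSum a (formTerm farVec) : ℝ) ≤ 0 := by exact_mod_cast h
  have hpos : 0 < 94 * qMin G - 15 * (Fintype.card V : ℝ) := by linarith
  have hnear : 0 ≤ ∑ v, ∑ w, (testVec a nearVec v w : ℝ) ^ 2 := by positivity
  have hfar : 0 < ∑ v, ∑ w, (testVec a farVec v w : ℝ) ^ 2 := by
    refine Finset.sum_pos (fun v _ => Finset.sum_pos (fun w _ => ?_) Finset.univ_nonempty)
      Finset.univ_nonempty
    have := testVec_farVec_ne_zero a v w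
    positivity
  have h₁ := qMin_sub_mul_le_homSum_formTerm G nearVec
  have h₂ := qMin_sub_mul_le_homSum_formTerm G farVec
  have h₃ := mul_nonneg hpos.le hnear
  have h₄ := mul_pos hpos hfar
  linarith

end Main

end TriangleFreeSpectra

theorem theorem2 {V : Type*} [Fintype V] [DecidableEq V] [Nonempty V]
    (G : SimpleGraph V) [DecidableRel G.Adj] (hG : G.CliqueFree 3) :
    (TriangleFreeSpectra.qMin G ≤ 15 / 94 * (Fintype.card V : ℝ) ∧
      15 / 94 * (Fintype.card V : ℝ) < 0.1596 * (Fintype.card V : ℝ)) ∧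
    (∀ d : ℕ, G.IsRegularOfDegree d →
      TriangleFreeSpectra.adjMax G + TriangleFreeSpectra.adjMin G
          < 0.1596 * (Fintype.card V : ℝ) ∧
        0.1596 * (Fintype.card V : ℝ) < 4 * (Fintype.card V : ℝ) / 25) := by
  have hn : (0 : ℝ) < Fintype.card V := by exact_mod_cast Fintype.card_pos
  have hq := TriangleFreeSpectra.qMin_le_of_cliqueFree_three G hG
  refine ⟨⟨hq, by linarith⟩, fun d hd => ⟨?_, by linarith⟩⟩
  linarith [TriangleFreeSpectra.adjMax_le_of_isRegularOfDegree G hd,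
    TriangleFreeSpectra.add_adjMin_le_qMin G hd]
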